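/- Consider constrained-degree percolation in random environment on the square lattice $\mathbb{L}^2=(\mathbb{Z}^2,\mathcal{E})$. Let $\rho=(\rho_0,\rho_1,\rho_2,\rho_3)$ be a probability vector. Let the constraints $\kappa_v$, $v\in\mathbb{Z}^2$, be i.i.d. with $\mathbb{P}(\kappa_v=j)=\rho_j$ for $j\in\{0,1,2,3\}$, and let the clocks $U_e$, $e\in\mathcal{E}$, be i.i.d. uniform on $(0,1]$ and independent of the constraints. At time $0$ all edges are closed. At time $U_e$ the edge $e=\langle u,v\rangle$ attempts to open, and it succeeds if and only if, just before time $U_e$, the number of open edges at $u$ is smaller than $\kappa_u$ and the number of open edges at $v$ is smaller than $\kappa_v$; once open, an edge remains open. (Almost surely this determines the state of every edge at every time.) Let $C_t$ be the set of vertices connected to the origin by a path of edges that are open at time $t$, and let $$\bar t_c(\rho)=\sup\{t\in[0,1]:\mathbb{E}_\rho(|C_t|)<\infty\}.$$ For $n\ge 1$ let $\partial B(n)$ be the set of vertices of $B(n)=[-n,n]^2\cap\mathbb{Z}^2$ that are adjacent to a vertex outside $B(n)$, and let $\theta_n(t)$ be the probability that, at time $t$, the origin is connected to $\partial B(n)$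 by a path of open edges. Theorem. For every $\rho$, every $t\in[0,1]$ with $t<\bar t_c(\rho)$ and every $\epsilon>0$ there is a constant $\alpha=\alpha(\epsilon,\rho,t)>0$ such that $$\theta_n(t)\le\exp\left(-\alpha n^{1-\epsilon}\right)\qquad\text{for all } n\ge 1.$$ -/

import Mathlib

open MeasureTheory

noncomputable section

namespace CDPRE

/-- The square lattice: two points of `ℤ²` are adjacent when their `ℓ¹`-distance is `1`. -/
def squareLattice : SimpleGraph (ℤ × ℤ) where
  Adj u v := |u.1 - v.1| + |u.2 - v.2| = 1
  symm := ⟨fun u v h => by rw [abs_sub_comm v.1, abs_sub_comm v.2]; exact h⟩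
  loopless := ⟨fun u h => by simp at h⟩

/-- The edges of the square lattice. -/
abbrev Edge : Type := squareLattice.edgeSet

/-- `f` precedes `e`: the two edges share an endpoint and the clock of `f` rings before that of
`e`. -/
def Precedes (U : Edge → ℝ) (f e : Edge) : Prop :=
  (∃ v, v ∈ f.1 ∧ v ∈ e.1) ∧ U f < U e

open Classical in
/-- The attempt of the edge `e`, made at time `U e`, succeeds: each endpoint `v` of `e` has, just
before time `U e`, fewer than `κ v` open edges. This is a recursion along `Precedes U`, which is
well founded for almost every clock configuration `U` (there is almost surely no infinite path of
edges with decreasing clocks); on the remaining null set the value is irrelevant and all attempts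
are declared to fail. -/
def Succeeds (κ : ℤ × ℤ → Fin 4) (U : Edge → ℝ) (e : Edge) : Prop :=
  if hU : WellFounded (Precedes U) then
    hU.fix (C := fun _ => Prop)
      (fun e opened => ∀ v ∈ e.1,
        {f : Edge | v ∈ f.1 ∧ ∃ hf : Precedes U f e, opened f hf}.ncard < (κ v : ℕ)) e
  else False

/-- The edge `e` is open at time `t` (`ω_t(e) = 1`). -/
def IsOpenAt (κ : ℤ × ℤ → Fin 4) (U : Edge → ℝ) (t : ℝ) (e : Edge) : Prop :=
  U e ≤ t ∧ Succeeds κ U e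

/-- The recursion that characterises the model, in terms of degrees: `e` is open at time `t` iff
`U e ≤ t` and, for each endpoint `v` of `e`, the number of edges at `v` that opened strictly
before time `U e` is smaller than `κ v`. -/
theorem isOpenAt_iff (κ : ℤ × ℤ → Fin 4) (U : Edge → ℝ) (hU : WellFounded (Precedes U))
    (t : ℝ) (e : Edge) :
    IsOpenAt κ U t e ↔ U e ≤ t ∧ ∀ v ∈ e.1,
      {f : Edge | v ∈ f.1 ∧ U f < U e ∧ IsOpenAt κ U (U f) f}.ncard < (κ v : ℕ) := by
  unfold IsOpenAt
  refine and_congr_right fun _ => ?_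
  have key : Succeeds κ U e ↔ ∀ v ∈ e.1,
      {f : Edge | v ∈ f.1 ∧ ∃ _ : Precedes U f e, Succeeds κ U f}.ncard < (κ v : ℕ) := by
    simp only [Succeeds, dif_pos hU]
    rw [WellFounded.fix_eq]
  rw [key]
  refine forall₂_congr fun v hv => ?_
  have hset : {f : Edge | v ∈ f.1 ∧ ∃ _ : Precedes U f e, Succeeds κ U f} =
      {f : Edge | v ∈ f.1 ∧ U f < U e ∧ U f ≤ U f ∧ Succeeds κ U f} := by
    ext f
    simp only [Set.mem_ofPred_eq, Precedes, exists_prop, le_refl, true_and]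
    constructor
    · rintro ⟨h1, ⟨_, h2⟩, h3⟩
      exact ⟨h1, h2, h3⟩
    · rintro ⟨h1, h2, h3⟩
      exact ⟨h1, ⟨⟨v, h1, hv⟩, h2⟩, h3⟩
  rw [hset]

/-- The random subgraph of the square lattice formed by the edges that are open at time `t`. -/
def openGraph (κ : ℤ × ℤ → Fin 4) (U : Edge → ℝ) (t : ℝ) : SimpleGraph (ℤ × ℤ) where
  Adj u v := ∃ h : s(u, v) ∈ squareLattice.edgeSet, IsOpenAt κ U t ⟨s(u, v), h⟩
  symm := ⟨fun u v ⟨h, ho⟩ => by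
    have hs : s(v, u) = s(u, v) := Sym2.eq_swap
    simp only [hs]
    exact ⟨h, ho⟩⟩
  loopless := ⟨fun u ⟨h, _⟩ => squareLattice.loopless.irrefl u h⟩

/-- The open cluster of the origin at time `t`. -/
def cluster (κ : ℤ × ℤ → Fin 4) (U : Edge → ℝ) (t : ℝ) : Set (ℤ × ℤ) :=
  {v | (openGraph κ U t).Reachable 0 v}

/-- The uniform distribution on `(0, 1]`. -/
def uniformLaw : Measure ℝ := volume.restrict (Set.Ioc 0 1)

instance : IsProbabilityMeasure uniformLaw :=
  ⟨by simp [uniformLaw]⟩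

/-- The joint law of the constraints (i.i.d. with law `ρ`) and of the clocks (i.i.d. uniform on
`(0, 1]`, independent of the constraints). -/
def law (ρ : PMF (Fin 4)) : Measure ((ℤ × ℤ → Fin 4) × (Edge → ℝ)) :=
  (Measure.infinitePi fun _ : ℤ × ℤ => ρ.toMeasure).prod
    (Measure.infinitePi fun _ : Edge => uniformLaw)

/-- The expected size of the open cluster of the origin at time `t`, in `[0, ∞]`. -/
def expectedClusterSize (ρ : PMF (Fin 4)) (t : ℝ) : ENNReal :=
  ∫⁻ x, ((cluster x.1 x.2 t).encard : ENNReal) ∂(law ρ)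

/-- The susceptibility threshold. -/
def tBar (ρ : PMF (Fin 4)) : ℝ :=
  sSup {t : ℝ | t ∈ Set.Icc (0 : ℝ) 1 ∧ expectedClusterSize ρ t < ⊤}

/-- The box `[-n, n]²` of `ℤ²`. -/
def box (n : ℕ) : Set (ℤ × ℤ) := {v | |v.1| ≤ n ∧ |v.2| ≤ n}

/-- The vertex boundary: the vertices of `Γ` that are adjacent to some vertex outside `Γ`. -/
def vertexBoundary (Γ : Set (ℤ × ℤ)) : Set (ℤ × ℤ) :=
  {v | v ∈ Γ ∧ ∃ w, w ∉ Γ ∧ squareLattice.Adj v w}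

/-- The probability that the origin is connected to the boundary of `[-n, n]²` at time `t`. -/
def theta (ρ : PMF (Fin 4)) (n : ℕ) (t : ℝ) : ℝ :=
  (law ρ).real {x | ∃ v ∈ vertexBoundary (box n), (openGraph x.1 x.2 t).Reachable 0 v}

end CDPRE

end

noncomputable section

namespace CDPRE

open ProbabilityTheory Function
open scoped ENNReal

/-- Configurations of constraints and clocks. -/
abbrev Config : Type := (ℤ × ℤ → Fin 4) × (Edge → ℝ)

instance (ρ : PMF (Fin 4)) : IsProbabilityMeasure (law ρ) := by
  unfold law; infer_instance

/-- The σ-algebra generated by a single constraint or a single clock. -/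
@[reducible] def coordSigma : (ℤ × ℤ) ⊕ Edge → MeasurableSpace Config
  | .inl v => MeasurableSpace.comap (fun x => x.1 v) inferInstance
  | .inr e => MeasurableSpace.comap (fun x => x.2 e) inferInstance

theorem coordSigma_le (i : (ℤ × ℤ) ⊕ Edge) :
    coordSigma i ≤ (inferInstance : MeasurableSpace Config) := by
  cases i with
  | inl v => exact Measurable.comap_le (by fun_prop)
  | inr e => exact Measurable.comap_le (by fun_prop)

theorem iIndep_coordSigma (ρ : PMF (Fin 4)) : iIndep coordSigma (law ρ) := by
  classical
  rw [iIndep_iff]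
  intro s f hf
  have hl : ∀ v, ∃ t : Set (Fin 4), Sum.inl v ∈ s → f (.inl v) = (fun x : Config => x.1 v) ⁻¹' t := by
    intro v
    by_cases hv : Sum.inl v ∈ s
    · obtain ⟨t, -, ht⟩ := hf _ hv
      exact ⟨t, fun _ => ht.symm⟩
    · exact ⟨∅, fun h => absurd h hv⟩
  have hr : ∀ e, ∃ t : Set ℝ, MeasurableSet t ∧
      (Sum.inr e ∈ s → f (.inr e) = (fun x : Config => x.2 e) ⁻¹' t) := by
    intro e
    by_cases hv : Sum.inr e ∈ s
    · obtain ⟨t, hm, ht⟩ := hf _ hv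
      exact ⟨t, hm, fun _ => ht.symm⟩
    · exact ⟨∅, .empty, fun h => absurd h hv⟩
  choose a ha using hl
  choose b hbm hb using hr
  have hset : (⋂ i ∈ s, f i) =
      (Set.pi s.toLeft a) ×ˢ (Set.pi s.toRight b) := by
    ext x
    simp only [Set.mem_iInter, Set.mem_prod, Set.mem_pi, Finset.mem_coe, Finset.mem_toLeft,
      Finset.mem_toRight]
    constructor
    · intro h
      refine ⟨fun v hv => ?_, fun e he => ?_⟩
      · have := h _ hv
        rwa [ha v hv] at this
      · have := h _ he
        rwa [hb e he] at this
    · rintro ⟨h1, h2⟩ (v | e) hi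
      · rw [ha v hi]; exact h1 v hi
      · rw [hb e hi]; exact h2 e hi
  rw [hset, law, Measure.prod_prod, Measure.infinitePi_pi _ (fun _ _ => .of_discrete),
    Measure.infinitePi_pi _ (fun e _ => hbm e), Finset.prod_sum_eq_prod_toLeft_mul_prod_toRight]
  congr 1
  · refine Finset.prod_congr rfl fun v hv => ?_
    rw [ha v (Finset.mem_toLeft.1 hv)]
    have : (fun x : Config => x.1 v) ⁻¹' a v = (eval v ⁻¹' a v) ×ˢ Set.univ := by ext; simp
    rw [this, Measure.prod_prod, measure_univ, mul_one,
      (measurePreserving_eval_infinitePi _ v).measure_preimage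
        (MeasurableSet.of_discrete).nullMeasurableSet]
  · refine Finset.prod_congr rfl fun e he => ?_
    rw [hb e (Finset.mem_toRight.1 he)]
    have : (fun x : Config => x.2 e) ⁻¹' b e = Set.univ ×ˢ (eval e ⁻¹' b e) := by ext; simp
    rw [this, Measure.prod_prod, measure_univ, one_mul,
      (measurePreserving_eval_infinitePi _ e).measure_preimage (hbm e).nullMeasurableSet]

/-- The σ-algebra generated by the constraints and clocks indexed by `S`. -/
@[reducible] def localSigma (S : Set ((ℤ × ℤ) ⊕ Edge)) : MeasurableSpace Config := ⨆ i ∈ S, coordSigma i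

theorem localSigma_le (S : Set ((ℤ × ℤ) ⊕ Edge)) :
    localSigma S ≤ (inferInstance : MeasurableSpace Config) :=
  iSup₂_le fun i _ => coordSigma_le i

theorem localSigma_mono {S T : Set ((ℤ × ℤ) ⊕ Edge)} (h : S ⊆ T) :
    localSigma S ≤ localSigma T :=
  biSup_mono fun _ hi => h hi

theorem measurable_constraint {S : Set ((ℤ × ℤ) ⊕ Edge)} {v : ℤ × ℤ} (hv : Sum.inl v ∈ S) :
    Measurable[localSigma S] (fun x : Config => x.1 v) :=
  (comap_measurable _).mono (le_iSup₂_of_le (f := fun i _ => coordSigma i) _ hv le_rfl) le_rfl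

theorem measurable_clock {S : Set ((ℤ × ℤ) ⊕ Edge)} {e : Edge} (he : Sum.inr e ∈ S) :
    Measurable[localSigma S] (fun x : Config => x.2 e) :=
  (comap_measurable _).mono (le_iSup₂_of_le (f := fun i _ => coordSigma i) _ he le_rfl) le_rfl

theorem measure_inter_of_disjoint (ρ : PMF (Fin 4)) {S T : Set ((ℤ × ℤ) ⊕ Edge)}
    (hST : Disjoint S T) {A B : Set Config} (hA : MeasurableSet[localSigma S] A)
    (hB : MeasurableSet[localSigma T] B) : law ρ (A ∩ B) = law ρ A * law ρ B :=
  (Indep_iff _ _ _).1 (indep_iSup_of_disjoint coordSigma_le (iIndep_coordSigma ρ) hST) A B hA hB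

/-- Events attached to the members of a list, each local to a set, the sets being pairwise
disjoint, are independent. -/
theorem measure_biInter_list_le (ρ : PMF (Fin 4)) {ι : Type*} (S : ι → Set ((ℤ × ℤ) ⊕ Edge))
    (A : ι → Set Config) (hA : ∀ i, MeasurableSet[localSigma (S i)] (A i)) (p : ℝ≥0∞)
    (hp : ∀ i, law ρ (A i) ≤ p) (l : List ι) (hl : l.Pairwise fun i j => Disjoint (S i) (S j)) :
    MeasurableSet[localSigma (⋃ i ∈ l, S i)] {x | ∀ i ∈ l, x ∈ A i} ∧
      law ρ {x | ∀ i ∈ l, x ∈ A i} ≤ p ^ l.length := by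
  induction l with
  | nil => simp
  | cons i l ih =>
    rw [List.pairwise_cons] at hl
    obtain ⟨hm, hle⟩ := ih hl.2
    have hset : {x | ∀ j ∈ i :: l, x ∈ A j} = A i ∩ {x | ∀ j ∈ l, x ∈ A j} := by
      ext x; simp
    have hdisj : Disjoint (S i) (⋃ j ∈ l, S j) := by
      simp only [Set.disjoint_iUnion_right]
      exact hl.1
    rw [hset]
    constructor
    · refine MeasurableSet.inter (localSigma_mono ?_ _ (hA i)) (localSigma_mono ?_ _ hm)
      · exact Set.subset_iUnion₂_of_subset i (by simp) le_rfl
      · exact Set.iUnion₂_subset fun j hj => Set.subset_iUnion₂_of_subset j (by simp [hj]) le_rfl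
    · rw [measure_inter_of_disjoint ρ hdisj (hA i) hm, List.length_cons, pow_succ, mul_comm]
      exact mul_le_mul' hle (hp i)

/-- Relabelling independent identically distributed coordinates along an injection. -/
theorem measure_strictAnti_comp (ν : Measure ℝ) [IsProbabilityMeasure ν] {ι : Type*} {k : ℕ}
    (e : Fin k → ι) (he : Injective e) :
    Measure.infinitePi (fun _ : ι => ν) {U | StrictAnti (U ∘ e)} =
      Measure.infinitePi (fun _ : Fin k => ν) {U | StrictAnti U} := by
  have hmeas : MeasurableSet {U : Fin k → ℝ | StrictAnti U} := by
    have : {U : Fin k → ℝ | StrictAnti U} = ⋂ i, ⋂ j, ⋂ _ : i < j, {U | U j < U i} := by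
      ext U; simp [StrictAnti]
    rw [this]
    exact .iInter fun i => .iInter fun j => .iInter fun _ =>
      measurableSet_lt (measurable_pi_apply j) (measurable_pi_apply i)
  rw [← Measure.map_infinitePi_infinitePi_of_inj (P := fun _ : ι => ν) he,
    Measure.map_apply (by fun_prop) hmeas]
  rfl

theorem perm_eq_of_strictAnti {k : ℕ} {g : Fin k → ℝ} {σ τ : Equiv.Perm (Fin k)}
    (hσ : StrictAnti (g ∘ σ)) (hτ : StrictAnti (g ∘ τ)) : σ = τ := by
  have hlt : ∀ i j, (σ⁻¹ * τ) i < (σ⁻¹ * τ) j ↔ i < j := by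
    intro i j
    rw [← hσ.lt_iff_gt, ← hτ.lt_iff_gt (a := j) (b := i)]
    simp
  have hle : ∀ i j, (σ⁻¹ * τ) i ≤ (σ⁻¹ * τ) j ↔ i ≤ j := fun i j => by
    rw [← not_lt, ← not_lt, hlt]
  have : (⟨σ⁻¹ * τ, hle _ _⟩ : Fin k ≃o Fin k) = OrderIso.refl _ := Subsingleton.elim _ _
  have h1 : σ⁻¹ * τ = 1 := congrArg RelIso.toEquiv this
  exact inv_mul_eq_one.1 h1

theorem factorial_mul_measure_strictAnti_le (ν : Measure ℝ) [IsProbabilityMeasure ν] {ι : Type*}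
    {k : ℕ} (e : Fin k → ι) (he : Injective e) :
    (k.factorial : ℝ≥0∞) * Measure.infinitePi (fun _ : ι => ν) {U | StrictAnti (U ∘ e)} ≤ 1 := by
  set P := Measure.infinitePi (fun _ : ι => ν)
  set E : Equiv.Perm (Fin k) → Set (ι → ℝ) := fun σ => {U | StrictAnti (U ∘ (e ∘ σ))}
  have hE : ∀ σ, P (E σ) = P {U | StrictAnti (U ∘ e)} := fun σ => by
    rw [measure_strictAnti_comp ν e he,
      ← measure_strictAnti_comp ν (e ∘ σ) (he.comp σ.injective)]
  have hmeas : ∀ σ, MeasurableSet (E σ) := by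
    intro σ
    have : E σ = ⋂ i, ⋂ j, ⋂ _ : i < j, {U | U (e (σ j)) < U (e (σ i))} := by
      ext U; simp [E, StrictAnti]
    rw [this]
    exact .iInter fun i => .iInter fun j => .iInter fun _ =>
      measurableSet_lt (measurable_pi_apply _) (measurable_pi_apply _)
  have hdisj : Pairwise (Disjoint on E) := fun σ τ hne =>
    Set.disjoint_left.2 fun U h1 h2 => hne (perm_eq_of_strictAnti (g := U ∘ e) h1 h2)
  have hsum : ∑ σ, P (E σ) = (k.factorial : ℝ≥0∞) * P {U | StrictAnti (U ∘ e)} := by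
    simp [hE, Fintype.card_perm]
  rw [← hsum, ← tsum_fintype (L := SummationFilter.unconditional _), ← measure_iUnion hdisj hmeas]
  exact prob_le_one

/-- A given list of `k` edges has decreasing clocks with probability at most `1 / k!`. -/
theorem measure_descending_list_le (ρ : PMF (Fin 4)) (l : List Edge) :
    law ρ {x | l.Pairwise fun a b => x.2 b < x.2 a} ≤ ((l.length.factorial : ℝ≥0∞))⁻¹ := by
  by_cases hl : l.Nodup
  · have hset : {x : Config | l.Pairwise fun a b => x.2 b < x.2 a} =
        Set.univ ×ˢ {U | StrictAnti (U ∘ l.get)} := by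
      ext x
      simp [List.pairwise_iff_get, StrictAnti]
    rw [hset, law, Measure.prod_prod, measure_univ, one_mul, ENNReal.le_inv_iff_mul_le, mul_comm]
    exact factorial_mul_measure_strictAnti_le uniformLaw _ (List.nodup_iff_injective_get.1 hl)
  · have hset : {x : Config | l.Pairwise fun a b => x.2 b < x.2 a} = ∅ := by
      ext x
      simp only [Set.mem_ofPred_eq, Set.mem_empty_iff_false, iff_false]
      exact fun h => hl (h.imp fun hab => fun hh => by simp [hh] at hab)
    simp [hset]

/-- The lists `[a₀, …, aₘ]` with `a₀ = a` and `aᵢ₊₁ ∈ nb aᵢ`. -/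
def walks {α : Type*} [DecidableEq α] (nb : α → Finset α) : ℕ → α → Finset (List α)
  | 0, a => {[a]}
  | m + 1, a => (nb a).biUnion fun b => (walks nb m b).image (a :: ·)

section walks

variable {α : Type*} [DecidableEq α] {nb : α → Finset α}

theorem card_walks_le {C : ℕ} (hC : ∀ a, (nb a).card ≤ C) (m : ℕ) (a : α) :
    (walks nb m a).card ≤ C ^ m := by
  induction m generalizing a with
  | zero => simp [walks]
  | succ m ih =>
    rw [walks, pow_succ, mul_comm]
    refine Finset.card_biUnion_le.trans ((Finset.sum_le_card_nsmul _ _ (C ^ m) ?_).trans ?_)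
    · exact fun b _ => Finset.card_image_le.trans (ih b)
    · rw [smul_eq_mul]; exact Nat.mul_le_mul_right _ (hC a)

theorem length_of_mem_walks {m : ℕ} {a : α} {l : List α} (h : l ∈ walks nb m a) :
    l.length = m + 1 := by
  induction m generalizing a l with
  | zero => simp [walks] at h; simp [h]
  | succ m ih =>
    simp only [walks, Finset.mem_biUnion, Finset.mem_image] at h
    obtain ⟨b, -, l', hl', rfl⟩ := h
    simp [ih hl']

end walks

/-- The sup norm on `ℤ²`. -/
def nm (v : ℤ × ℤ) : ℕ := max v.1.natAbs v.2.natAbs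

theorem adj_iff {u v : ℤ × ℤ} :
    squareLattice.Adj u v ↔ (u.1 - v.1).natAbs + (u.2 - v.2).natAbs = 1 := by
  change |u.1 - v.1| + |u.2 - v.2| = 1 ↔ _
  rw [Int.abs_eq_natAbs, Int.abs_eq_natAbs]
  omega

theorem nm_sub_le_of_adj {u v x : ℤ × ℤ} (h : squareLattice.Adj u v) :
    nm (v - x) ≤ nm (u - x) + 1 := by
  rw [adj_iff] at h
  simp only [nm, Prod.fst_sub, Prod.snd_sub]
  omega

theorem nm_le_of_adj {u v : ℤ × ℤ} (h : squareLattice.Adj u v) : nm v ≤ nm u + 1 := by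
  simpa using nm_sub_le_of_adj (x := 0) h

theorem finite_nm_le (N : ℕ) : {v : ℤ × ℤ | nm v ≤ N}.Finite := by
  refine (Set.finite_Icc ((-N, -N) : ℤ × ℤ) (N, N)).subset fun v hv => ?_
  simp only [nm, Set.mem_ofPred_eq] at hv
  simp only [Set.mem_Icc, Prod.le_def]
  omega

/-- The vertices at distance `N` from `x`. -/
def ring (N : ℕ) (x : ℤ × ℤ) : Finset (ℤ × ℤ) :=
  (Finset.Icc (-N : ℤ) N).biUnion fun i =>
    {x + (i, (N : ℤ)), x + (i, -(N : ℤ)), x + ((N : ℤ), i), x + (-(N : ℤ), i)}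

theorem mem_ring {N : ℕ} {x v : ℤ × ℤ} (h : nm (v - x) = N) : v ∈ ring N x := by
  simp only [nm, Prod.fst_sub, Prod.snd_sub] at h
  simp only [ring, Finset.mem_biUnion, Finset.mem_Icc, Finset.mem_insert, Finset.mem_singleton,
    Prod.ext_iff, Prod.fst_add, Prod.snd_add]
  by_cases h1 : (v.1 - x.1).natAbs = N
  · exact ⟨v.2 - x.2, by omega, by omega⟩
  · exact ⟨v.1 - x.1, by omega, by omega⟩

theorem card_ring_le (N : ℕ) (x : ℤ × ℤ) : (ring N x).card ≤ 4 * (2 * N + 1) := by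
  refine Finset.card_biUnion_le.trans
    ((Finset.sum_le_card_nsmul _ _ 4 fun i _ => Finset.card_le_four).trans ?_)
  simp only [Int.card_Icc, smul_eq_mul]
  omega

/-- Both endpoints of `e` are at distance at most `N` from the origin. -/
def InBox (N : ℕ) (e : Edge) : Prop := ∀ v ∈ e.1, nm v ≤ N

theorem InBox.mono {M N : ℕ} (h : M ≤ N) {e : Edge} (he : InBox M e) : InBox N e :=
  fun v hv => (he v hv).trans h

theorem Edge.exists_eq (e : Edge) : ∃ u v, ∃ h : squareLattice.Adj u v, e = ⟨s(u, v), h⟩ := by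
  obtain ⟨e, he⟩ := e
  induction e using Sym2.inductionOn with
  | hf u v => exact ⟨u, v, he, rfl⟩

theorem nm_le_of_mem_edge {e : Edge} {u v : ℤ × ℤ} (hu : u ∈ e.1) (hv : v ∈ e.1) :
    nm v ≤ nm u + 1 := by
  obtain ⟨a, b, hab, rfl⟩ := e.exists_eq
  simp only [Sym2.mem_iff] at hu hv
  rcases hu with rfl | rfl <;> rcases hv with rfl | rfl
  · omega
  · exact nm_le_of_adj hab
  · exact nm_le_of_adj hab.symm
  · omega

theorem InBox.succ_of_precedes {U : Edge → ℝ} {N : ℕ} {e f : Edge} (he : InBox N e)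
    (h : Precedes U f e) : InBox (N + 1) f := by
  obtain ⟨⟨v, hvf, hve⟩, -⟩ := h
  exact fun w hw => (nm_le_of_mem_edge hvf hw).trans (Nat.add_le_add_right (he v hve) 1)

open Classical in
/-- The edges at the vertex `v`. -/
def incident (v : ℤ × ℤ) : Finset Edge :=
  ({v + (1, 0), v + (-1, 0), v + (0, 1), v + (0, -1)} : Finset (ℤ × ℤ)).biUnion fun w =>
    if h : squareLattice.Adj v w then {⟨s(v, w), h⟩} else ∅

theorem mem_incident {v : ℤ × ℤ} {e : Edge} : e ∈ incident v ↔ v ∈ e.1 := by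
  classical
  simp only [incident, Finset.mem_biUnion]
  constructor
  · rintro ⟨w, -, hw⟩
    split_ifs at hw with h
    · rw [Finset.mem_singleton] at hw
      simp [hw]
    · simp at hw
  · intro hv
    obtain ⟨w, hw⟩ := Sym2.mem_iff_exists.1 hv
    have hadj : squareLattice.Adj v w := by
      have := e.2
      rwa [hw] at this
    refine ⟨w, ?_, by simp [hadj, Subtype.ext_iff, hw]⟩
    rw [adj_iff] at hadj
    simp only [Finset.mem_insert, Finset.mem_singleton, Prod.ext_iff, Prod.fst_add, Prod.snd_add]
    omega

theorem card_incident_le (v : ℤ × ℤ) : (incident v).card ≤ 4 := by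
  classical
  refine Finset.card_biUnion_le.trans
    ((Finset.sum_le_card_nsmul _ _ 1 fun w _ => ?_).trans ?_)
  · split_ifs <;> simp
  · simp

theorem finite_inBox (N : ℕ) : {e : Edge | InBox N e}.Finite := by
  refine ((finite_nm_le N).biUnion fun v _ => (incident v).finite_toSet).subset fun e he => ?_
  obtain ⟨v, hv⟩ : ∃ v, v ∈ e.1 := ⟨e.1.out.1, Sym2.out_fst_mem _⟩
  exact Set.mem_biUnion (he v hv) (mem_incident.2 hv)

/-- The edges in the box, as a finset. -/
def boxEdges (N : ℕ) : Finset Edge := (finite_inBox N).toFinset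

theorem mem_boxEdges {N : ℕ} {e : Edge} : e ∈ boxEdges N ↔ InBox N e := by
  simp [boxEdges]

theorem card_boxEdges_le (N : ℕ) : (boxEdges N).card ≤ 4 * (2 * N + 1) ^ 2 := by
  classical
  have hsub : boxEdges N ⊆
      (Finset.Icc (-N : ℤ) N ×ˢ Finset.Icc (-N : ℤ) N).biUnion incident := by
    intro e he
    rw [mem_boxEdges] at he
    obtain ⟨v, hv⟩ : ∃ v, v ∈ e.1 := ⟨e.1.out.1, Sym2.out_fst_mem _⟩
    have := he v hv
    simp only [nm] at this
    refine Finset.mem_biUnion.2 ⟨v, ?_, mem_incident.2 hv⟩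
    simp only [Finset.mem_product, Finset.mem_Icc]
    omega
  refine (Finset.card_le_card hsub).trans (Finset.card_biUnion_le.trans
    ((Finset.sum_le_card_nsmul _ _ 4 fun v _ => card_incident_le v).trans ?_))
  rw [Finset.card_product, Int.card_Icc, smul_eq_mul]
  have : ((N : ℤ) + 1 - -N).toNat = 2 * N + 1 := by omega
  rw [this]
  nlinarith

open Classical in
/-- The edges sharing an endpoint with `e`. -/
def edgeNeighbors (e : Edge) : Finset Edge := incident e.1.out.1 ∪ incident e.1.out.2

theorem mem_edgeNeighbors {e f : Edge} (h : ∃ v, v ∈ f.1 ∧ v ∈ e.1) : f ∈ edgeNeighbors e := by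
  classical
  obtain ⟨v, hf, he⟩ := h
  have : e.1 = s(e.1.out.1, e.1.out.2) := (Quot.out_eq e.1).symm
  rw [this, Sym2.mem_iff] at he
  rw [edgeNeighbors, Finset.mem_union, mem_incident, mem_incident]
  rcases he with rfl | rfl
  · exact .inl hf
  · exact .inr hf

theorem card_edgeNeighbors_le (e : Edge) : (edgeNeighbors e).card ≤ 8 := by
  classical
  exact (Finset.card_union_le _ _).trans
    (Nat.add_le_add (card_incident_le _) (card_incident_le _))

/-- There is a chain of `m + 1` successively adjacent edges with decreasing clocks, starting
with `e`. -/
def HasDescent (U : Edge → ℝ) : ℕ → Edge → Prop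
  | 0, _ => True
  | m + 1, e => ∃ f, Precedes U f e ∧ HasDescent U m f

open Classical in
theorem HasDescent.exists_mem_walks {U : Edge → ℝ} {m : ℕ} {e : Edge} (h : HasDescent U m e) :
    ∃ l ∈ walks edgeNeighbors m e, l.Pairwise (fun a b => U b < U a) ∧ ∀ f ∈ l, U f ≤ U e := by
  induction m generalizing e with
  | zero => exact ⟨[e], by simp [walks], by simp, by simp⟩
  | succ m ih =>
    obtain ⟨f, hfe, hf⟩ := h
    obtain ⟨l, hl, hp, hle⟩ := ih hf
    refine ⟨e :: l, ?_, ?_, ?_⟩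
    · simp only [walks, Finset.mem_biUnion, Finset.mem_image]
      exact ⟨f, mem_edgeNeighbors hfe.1, l, hl, rfl⟩
    · exact List.pairwise_cons.2 ⟨fun g hg => (hle g hg).trans_lt hfe.2, hp⟩
    · intro g hg
      rcases List.mem_cons.1 hg with rfl | hg
      · exact le_rfl
      · exact (hle g hg).trans hfe.2.le

theorem measure_hasDescent_le (ρ : PMF (Fin 4)) (m : ℕ) (e : Edge) :
    law ρ {x | HasDescent x.2 m e} ≤ 8 ^ m * (((m + 1).factorial : ℝ≥0∞))⁻¹ := by
  classical
  have hsub : {x : Config | HasDescent x.2 m e} ⊆ ⋃ l ∈ walks edgeNeighbors m e,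
      {x : Config | l.Pairwise fun a b => x.2 b < x.2 a} := by
    intro x hx
    obtain ⟨l, hl, hp, -⟩ := hx.exists_mem_walks
    exact Set.mem_biUnion hl hp
  refine (measure_mono hsub).trans ((measure_biUnion_finset_le _ _).trans
    ((Finset.sum_le_card_nsmul _ _ (((m + 1).factorial : ℝ≥0∞))⁻¹ fun l hl => ?_).trans ?_))
  · rw [← length_of_mem_walks hl]
    exact measure_descending_list_le ρ l
  · rw [nsmul_eq_mul]
    gcongr
    exact_mod_cast card_walks_le card_edgeNeighbors_le m e

theorem tendsto_pow_mul_descent (j : ℕ) :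
    Filter.Tendsto (fun m : ℕ => (m : ℝ) ^ j * (8 ^ m / ((m + 1).factorial : ℝ)))
      Filter.atTop (nhds 0) := by
  have h1 : Filter.Tendsto (fun m : ℕ => (m : ℝ) ^ j * (1 / 2 : ℝ) ^ m)
      Filter.atTop (nhds 0) :=
    tendsto_pow_const_mul_const_pow_of_abs_lt_one j (by rw [abs_of_pos] <;> norm_num)
  have h2 : Filter.Tendsto (fun m : ℕ => (16 : ℝ) ^ m / (m.factorial : ℝ))
      Filter.atTop (nhds 0) := FloorSemiring.tendsto_pow_div_factorial_atTop 16
  have h3 := h1.mul h2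
  rw [mul_zero] at h3
  refine squeeze_zero (fun m => by positivity) (fun m => ?_) h3
  have h4 : ((1 / 2 : ℝ) ^ m) * 16 ^ m = 8 ^ m := by rw [← mul_pow]; norm_num
  calc (m : ℝ) ^ j * (8 ^ m / ((m + 1).factorial : ℝ))
      ≤ (m : ℝ) ^ j * (8 ^ m / (m.factorial : ℝ)) := by
        gcongr
        exact Nat.le_succ m
    _ = (m : ℝ) ^ j * (1 / 2 : ℝ) ^ m * (16 ^ m / (m.factorial : ℝ)) := by rw [← h4]; ring

/-- Almost surely there is no infinite chain of edges with decreasing clocks. -/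
theorem ae_wellFounded (ρ : PMF (Fin 4)) : ∀ᵐ x ∂(law ρ), WellFounded (Precedes x.2) := by
  have hE : ∀ e : Edge, ∀ᵐ x ∂(law ρ), ¬ ∀ m, HasDescent x.2 m e := by
    intro e
    rw [ae_iff]
    simp only [not_not]
    have hlim : Filter.Tendsto (fun m : ℕ => ENNReal.ofReal (8 ^ m / ((m + 1).factorial : ℝ)))
        Filter.atTop (nhds 0) := by
      have := tendsto_pow_mul_descent 0
      simp only [pow_zero, one_mul] at this
      simpa using ENNReal.tendsto_ofReal this
    refine le_antisymm (ge_of_tendsto' hlim fun m => ?_) zero_le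
    refine (measure_mono fun x hx => ?_).trans ((measure_hasDescent_le ρ m e).trans_eq ?_)
    · exact hx m
    · rw [ENNReal.ofReal_div_of_pos (by positivity), ENNReal.ofReal_pow (by norm_num),
        ENNReal.ofReal_natCast, div_eq_mul_inv]
      norm_num
  have : Countable Edge := by unfold Edge; infer_instance
  filter_upwards [ae_all_iff.2 hE] with x hx
  rw [wellFounded_iff_isEmpty_descending_chain]
  refine ⟨fun ⟨f, hf⟩ => hx (f 0) fun m => ?_⟩
  have : ∀ m n, HasDescent x.2 m (f n) := by
    intro m
    induction m with
    | zero => exact fun _ => trivial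
    | succ m ih => exact fun n => ⟨f (n + 1), hf n, ih _⟩
  exact this m 0

theorem succeeds_iff {κ : ℤ × ℤ → Fin 4} {U : Edge → ℝ} (hU : WellFounded (Precedes U))
    (e : Edge) : Succeeds κ U e ↔ ∀ v ∈ e.1,
      {f : Edge | v ∈ f.1 ∧ Precedes U f e ∧ Succeeds κ U f}.ncard < (κ v : ℕ) := by
  simp only [Succeeds, dif_pos hU]
  rw [WellFounded.fix_eq]
  simp only [exists_prop]

/-- The success of an attempt is determined by the constraints and by the order of the clocks
along adjacent edges. -/
theorem succeeds_congr {κ : ℤ × ℤ → Fin 4} {U U' : Edge → ℝ} (h : Precedes U = Precedes U')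
    (e : Edge) : Succeeds κ U e ↔ Succeeds κ U' e := by
  by_cases hU : WellFounded (Precedes U)
  · have hU' := h ▸ hU
    induction e using hU.induction with
    | _ e ih =>
      rw [succeeds_iff hU, succeeds_iff hU', ← h]
      refine forall₂_congr fun v _ => ?_
      have : {f : Edge | v ∈ f.1 ∧ Precedes U f e ∧ Succeeds κ U f} =
          {f : Edge | v ∈ f.1 ∧ Precedes U f e ∧ Succeeds κ U' f} := by
        ext f
        exact and_congr_right fun _ => and_congr_right fun hf => ih f hf
      rw [this]
  · have hU' := h ▸ hU
    simp [Succeeds, hU, hU']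

theorem openGraph_mono (κ : ℤ × ℤ → Fin 4) (U : Edge → ℝ) {s t : ℝ} (h : s ≤ t) :
    openGraph κ U s ≤ openGraph κ U t :=
  fun _ _ ⟨hs, ho⟩ => ⟨hs, ho.1.trans h, ho.2⟩

theorem expectedClusterSize_mono (ρ : PMF (Fin 4)) {s t : ℝ} (h : s ≤ t) :
    expectedClusterSize ρ s ≤ expectedClusterSize ρ t := by
  refine lintegral_mono fun x => ?_
  refine ENat.toENNReal_mono (Set.encard_le_encard fun v hv => ?_)
  exact SimpleGraph.Reachable.mono (openGraph_mono _ _ h) hv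

section truncation

/-- The constraints, set to `0` outside the box. -/
def truncConstraint (N : ℕ) (κ : ℤ × ℤ → Fin 4) : ℤ × ℤ → Fin 4 :=
  fun v => if nm v ≤ N then κ v else 0

open Classical in
/-- The clocks, cut off at `1` in the box and equal to `2` outside. -/
def truncClock (N : ℕ) (U : Edge → ℝ) : Edge → ℝ :=
  fun e => if InBox N e then min (U e) 1 else 2

theorem truncClock_of_inBox {N : ℕ} {U : Edge → ℝ} {e : Edge} (he : InBox N e) :
    truncClock N U e = min (U e) 1 := if_pos he

theorem truncClock_of_not_inBox {N : ℕ} {U : Edge → ℝ} {e : Edge} (he : ¬ InBox N e) :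
    truncClock N U e = 2 := if_neg he

theorem wellFounded_truncClock (N : ℕ) (U : Edge → ℝ) :
    WellFounded (Precedes (truncClock N U)) := by
  rw [wellFounded_iff_isEmpty_descending_chain]
  refine ⟨fun ⟨f, hf⟩ => ?_⟩
  have hanti : StrictAnti fun n => truncClock N U (f n) := strictAnti_nat_of_succ_lt fun n => (hf n).2
  refine Set.infinite_range_of_injective hanti.injective ?_
  refine (((finite_inBox N).image (truncClock N U)).insert 2).subset ?_
  rintro _ ⟨n, rfl⟩
  by_cases h : InBox N (f n)
  · exact .inr ⟨_, h, rfl⟩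
  · exact .inl (truncClock_of_not_inBox h)

theorem precedes_truncClock_iff {N : ℕ} {U : Edge → ℝ} {e f : Edge} (he : InBox N e)
    (hU : U e ≤ 1) (hf : (∃ v, v ∈ f.1 ∧ v ∈ e.1) → U f < U e → InBox N f) :
    Precedes (truncClock N U) f e ↔ Precedes U f e := by
  refine and_congr_right fun hv => ?_
  rw [truncClock_of_inBox he, min_eq_left hU]
  by_cases h : InBox N f
  · rw [truncClock_of_inBox h]
    refine ⟨fun h' => ?_, fun h' => (min_le_left _ _).trans_lt h'⟩
    rcases min_lt_iff.1 h' with h' | h'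
    · exact h'
    · exact absurd h' (not_lt.2 hU)
  · rw [truncClock_of_not_inBox h]
    exact ⟨fun h' => by linarith, fun h' => absurd (hf hv h') h⟩

/-- Without long descending chains, the dynamics near the origin do not feel the truncation. -/
theorem succeeds_trunc_iff {κ : ℤ × ℤ → Fin 4} {U : Edge → ℝ} (hU : WellFounded (Precedes U))
    {N m r : ℕ} (hN : r + m ≤ N) {e : Edge} (he : InBox r e) (ht : U e ≤ 1)
    (hd : ¬ HasDescent U m e) :
    Succeeds (truncConstraint N κ) (truncClock N U) e ↔ Succeeds κ U e := by
  induction m generalizing r e with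
  | zero => exact absurd trivial hd
  | succ m ih =>
    rw [succeeds_iff hU, succeeds_iff (wellFounded_truncClock N U)]
    have hf : ∀ f, Precedes U f e → InBox (r + 1) f := fun f hf => he.succ_of_precedes hf
    refine forall₂_congr fun v hv => ?_
    have hset : {f : Edge | v ∈ f.1 ∧ Precedes (truncClock N U) f e ∧
          Succeeds (truncConstraint N κ) (truncClock N U) f} =
        {f : Edge | v ∈ f.1 ∧ Precedes U f e ∧ Succeeds κ U f} := by
      ext f
      refine and_congr_right fun _ => ?_
      rw [precedes_truncClock_iff (he.mono (by omega)) ht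
        fun h1 h2 => (hf f ⟨h1, h2⟩).mono (by omega)]
      refine and_congr_right fun hfe => ?_
      exact ih (r := r + 1) (by omega) (hf f hfe) (hfe.2.le.trans ht) fun h => hd ⟨f, hfe, h⟩
    have hκ : truncConstraint N κ v = κ v := if_pos ((he v hv).trans (by omega))
    rw [hset, hκ]

theorem isOpenAt_trunc_iff {κ : ℤ × ℤ → Fin 4} {U : Edge → ℝ} (hU : WellFounded (Precedes U))
    {L : ℕ} {t : ℝ} (ht : t < 1) {e : Edge} (he : InBox L e) (hd : ¬ HasDescent U L e) :
    IsOpenAt (truncConstraint (2 * L) κ) (truncClock (2 * L) U) t e ↔ IsOpenAt κ U t e := by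
  unfold IsOpenAt
  rw [truncClock_of_inBox (he.mono (by omega))]
  have h1 : min (U e) 1 ≤ t ↔ U e ≤ t := by simp [ht]
  rw [h1]
  exact and_congr_right fun h => succeeds_trunc_iff hU (by omega) he (h.trans ht.le) hd

/-- Some edge of the box starts a long descending chain. -/
def Bad (L : ℕ) (x : Config) : Prop := ∃ e, InBox L e ∧ HasDescent x.2 L e

/-- In the truncated dynamics, the origin is connected to distance `L`. -/
def TruncArm (L : ℕ) (t : ℝ) (x : Config) : Prop :=
  ∃ v, nm v = L ∧
    (openGraph (truncConstraint (2 * L) x.1) (truncClock (2 * L) x.2) t).Reachable 0 v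

theorem openGraph_le (κ : ℤ × ℤ → Fin 4) (U : Edge → ℝ) (t : ℝ) :
    openGraph κ U t ≤ squareLattice := fun _ _ ⟨h, _⟩ => h

/-- A connection to a far point gives a connection to distance `L` in any graph that has the same
edges in the box. -/
theorem exists_reachable_nm_eq {G H : SimpleGraph (ℤ × ℤ)} (hG : G ≤ squareLattice) {L : ℕ}
    (hGH : ∀ u v, nm u ≤ L → nm v ≤ L → G.Adj u v → H.Adj u v) {u v : ℤ × ℤ} (hu : nm u ≤ L)
    (hv : L ≤ nm v) (h : G.Reachable u v) : ∃ w, nm w = L ∧ H.Reachable u w := by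
  obtain ⟨p⟩ := h
  induction p with
  | nil => exact ⟨_, le_antisymm hu hv, .refl _⟩
  | @cons a b c hab p ih =>
    rcases hu.eq_or_lt with hu | hu
    · exact ⟨a, hu, .refl _⟩
    · have hb : nm b ≤ L := (nm_le_of_adj (hG hab)).trans hu
      obtain ⟨w, hw, hbw⟩ := ih hb hv
      exact ⟨w, hw, (hGH a b hu.le hb hab).reachable.trans hbw⟩

theorem inBox_mk {L : ℕ} {u v : ℤ × ℤ} (h : s(u, v) ∈ squareLattice.edgeSet) (hu : nm u ≤ L)
    (hv : nm v ≤ L) : InBox L ⟨s(u, v), h⟩ := by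
  intro w hw
  rcases Sym2.mem_iff.1 hw with rfl | rfl <;> assumption

theorem openGraph_trunc_adj_iff {x : Config} (hx : WellFounded (Precedes x.2)) {L : ℕ} {t : ℝ}
    (ht : t < 1) (hb : ¬ Bad L x) {u v : ℤ × ℤ} (hu : nm u ≤ L) (hv : nm v ≤ L) :
    (openGraph (truncConstraint (2 * L) x.1) (truncClock (2 * L) x.2) t).Adj u v ↔
      (openGraph x.1 x.2 t).Adj u v :=
  exists_congr fun hs => isOpenAt_trunc_iff hx ht (inBox_mk hs hu hv)
    fun hd => hb ⟨_, inBox_mk hs hu hv, hd⟩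

theorem truncArm_of_reachable {x : Config} (hx : WellFounded (Precedes x.2)) {L : ℕ} {t : ℝ}
    (ht : t < 1) (hb : ¬ Bad L x) {v : ℤ × ℤ} (hv : L ≤ nm v)
    (h : (openGraph x.1 x.2 t).Reachable 0 v) : TruncArm L t x :=
  exists_reachable_nm_eq (openGraph_le _ _ _)
    (fun _ _ h1 h2 => (openGraph_trunc_adj_iff hx ht hb h1 h2).2) (by simp [nm]) hv h

theorem exists_mem_cluster_of_truncArm {x : Config} (hx : WellFounded (Precedes x.2)) {L : ℕ}
    {t : ℝ} (ht : t < 1) (hb : ¬ Bad L x) (h : TruncArm L t x) :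
    ∃ w ∈ cluster x.1 x.2 t, nm w = L := by
  obtain ⟨v, hv, h⟩ := h
  obtain ⟨w, hw, h⟩ := exists_reachable_nm_eq (openGraph_le _ _ _)
    (fun _ _ h1 h2 => (openGraph_trunc_adj_iff hx ht hb h1 h2).1) (by simp [nm]) hv.ge h
  exact ⟨w, h, hw⟩

end truncation

section locality

/-- The sites carrying the constraints and clocks of the box. -/
def boxSites (N : ℕ) : Set ((ℤ × ℤ) ⊕ Edge) := {i | Sum.elim (fun v => nm v ≤ N) (InBox N) i}

/-- The finite information about the box from which the local events are read off. -/
def boxData (N : ℕ) (t : ℝ) (x : Config) :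
    ({v : ℤ × ℤ // nm v ≤ N} → Fin 4) ×
      ({e : Edge // InBox N e} → {e : Edge // InBox N e} → Prop) ×
      ({e : Edge // InBox N e} → {e : Edge // InBox N e} → Prop) ×
      ({e : Edge // InBox N e} → Prop) :=
  (fun v => x.1 v, fun e f => x.2 f < x.2 e, fun e f => min (x.2 f) 1 < min (x.2 e) 1,
    fun e => min (x.2 e) 1 ≤ t)

theorem measurable_boxData (N : ℕ) (t : ℝ) :
    Measurable[localSigma (boxSites N)] (boxData N t) := by
  let _ : MeasurableSpace Config := localSigma (boxSites N)
  have hU : ∀ e : {e : Edge // InBox N e}, Measurable fun x : Config => x.2 e :=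
    fun e => measurable_clock e.2
  have hκ : ∀ v : {v : ℤ × ℤ // nm v ≤ N}, Measurable fun x : Config => x.1 v :=
    fun v => measurable_constraint v.2
  refine (measurable_pi_lambda _ hκ).prodMk (Measurable.prodMk ?_ (Measurable.prodMk ?_ ?_))
  · exact measurable_pi_lambda _ fun e => measurable_pi_lambda _ fun f =>
      measurableSet_setOfPred.1 (measurableSet_lt (hU f) (hU e))
  · exact measurable_pi_lambda _ fun e => measurable_pi_lambda _ fun f =>
      measurableSet_setOfPred.1
        (measurableSet_lt ((hU f).min measurable_const) ((hU e).min measurable_const))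
  · exact measurable_pi_lambda _ fun e =>
      measurableSet_setOfPred.1 (measurableSet_le ((hU e).min measurable_const) measurable_const)

theorem measurableSet_of_boxData (N : ℕ) (t : ℝ) {Q : Config → Prop}
    (hQ : ∀ x y, boxData N t x = boxData N t y → Q x → Q y) :
    MeasurableSet[localSigma (boxSites N)] {x | Q x} := by
  have h1 : Finite {v : ℤ × ℤ // nm v ≤ N} := (finite_nm_le N).to_subtype
  have h2 : Finite {e : Edge // InBox N e} := (finite_inBox N).to_subtype
  have : {x | Q x} = boxData N t ⁻¹' (boxData N t '' {x | Q x}) := by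
    refine Set.Subset.antisymm (Set.subset_preimage_image _ _) ?_
    rintro y ⟨x, hx, hxy⟩
    exact hQ x y hxy hx
  rw [this]
  exact measurable_boxData N t (Set.toFinite _).measurableSet

theorem hasDescent_of_boxData {N : ℕ} {t : ℝ} {x y : Config} (h : boxData N t x = boxData N t y)
    {m r : ℕ} (hr : r + m ≤ N) {e : Edge} (he : InBox r e) (hd : HasDescent x.2 m e) :
    HasDescent y.2 m e := by
  induction m generalizing r e with
  | zero => trivial
  | succ m ih =>
    obtain ⟨f, hfe, hf⟩ := hd
    have hf' := he.succ_of_precedes hfe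
    refine ⟨f, ⟨hfe.1, ?_⟩, ih (r := r + 1) (by omega) hf' hf⟩
    have h2 := congrFun (congrFun (congrArg (fun d => d.2.1) h) ⟨e, he.mono (by omega)⟩)
      ⟨f, hf'.mono (by omega)⟩
    exact (iff_of_eq h2).1 hfe.2

theorem precedes_truncClock_of_boxData {N : ℕ} {t : ℝ} {x y : Config}
    (h : boxData N t x = boxData N t y) :
    Precedes (truncClock N x.2) = Precedes (truncClock N y.2) := by
  ext f e
  refine and_congr_right fun _ => ?_
  by_cases he : InBox N e <;> by_cases hf : InBox N f
  · rw [truncClock_of_inBox he, truncClock_of_inBox hf, truncClock_of_inBox he,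
      truncClock_of_inBox hf]
    exact iff_of_eq (congrFun (congrFun (congrArg (fun d => d.2.2.1) h) ⟨e, he⟩) ⟨f, hf⟩)
  · simp only [truncClock_of_inBox he, truncClock_of_not_inBox hf]
    have h1 := min_le_right (x.2 e) 1
    have h2 := min_le_right (y.2 e) 1
    constructor <;> intro _ <;> linarith
  · simp only [truncClock_of_inBox hf, truncClock_of_not_inBox he]
    have h1 := min_le_right (x.2 f) 1
    have h2 := min_le_right (y.2 f) 1
    constructor <;> intro _ <;> linarith
  · simp only [truncClock_of_not_inBox hf, truncClock_of_not_inBox he]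

theorem openGraph_trunc_of_boxData {N : ℕ} {t : ℝ} {x y : Config}
    (h : boxData N t x = boxData N t y) :
    openGraph (truncConstraint N x.1) (truncClock N x.2) t =
      openGraph (truncConstraint N y.1) (truncClock N y.2) t := by
  have hκ : truncConstraint N x.1 = truncConstraint N y.1 := by
    ext1 v
    unfold truncConstraint
    split_ifs with hv
    · exact congrFun (congrArg (fun d => d.1) h) ⟨v, hv⟩
    · rfl
  ext u v
  refine exists_congr fun hs => ?_
  unfold IsOpenAt
  rw [hκ, succeeds_congr (precedes_truncClock_of_boxData h)]
  refine and_congr_left fun _ => ?_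
  by_cases he : InBox N ⟨s(u, v), hs⟩
  · rw [truncClock_of_inBox he, truncClock_of_inBox he]
    exact iff_of_eq (congrFun (congrArg (fun d => d.2.2.2) h) ⟨_, he⟩)
  · rw [truncClock_of_not_inBox he, truncClock_of_not_inBox he]

theorem measurableSet_bad (L : ℕ) :
    MeasurableSet[localSigma (boxSites (2 * L))] {x | Bad L x} :=
  measurableSet_of_boxData (2 * L) 0 fun _ _ h ⟨e, he, hd⟩ =>
    ⟨e, he, hasDescent_of_boxData h (by omega) he hd⟩

theorem measurableSet_truncArm (L : ℕ) (t : ℝ) :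
    MeasurableSet[localSigma (boxSites (2 * L))] {x | TruncArm L t x} :=
  measurableSet_of_boxData (2 * L) t fun _ _ h ⟨v, hv, hr⟩ =>
    ⟨v, hv, openGraph_trunc_of_boxData h ▸ hr⟩

end locality

section shift

/-- Translation by `x` as an automorphism of the square lattice. -/
def shiftIso (x : ℤ × ℤ) : squareLattice ≃g squareLattice where
  toEquiv := Equiv.addRight x
  map_rel_iff' := by
    intro u v
    simp [adj_iff]

/-- Translation of edges. -/
def shiftEdge (x : ℤ × ℤ) : Edge ≃ Edge := (shiftIso x).mapEdgeSet

theorem shiftEdge_mk (x u v : ℤ × ℤ) (h : s(u, v) ∈ squareLattice.edgeSet)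
    (h' : s(u + x, v + x) ∈ squareLattice.edgeSet) :
    shiftEdge x ⟨s(u, v), h⟩ = ⟨s(u + x, v + x), h'⟩ := rfl

theorem mem_shiftEdge {x w : ℤ × ℤ} {e : Edge} : w ∈ (shiftEdge x e).1 ↔ w - x ∈ e.1 := by
  obtain ⟨u, v, h, rfl⟩ := e.exists_eq
  rw [shiftEdge_mk x u v h ((shiftIso x).map_adj_iff.2 h)]
  simp only [Sym2.mem_iff, sub_eq_iff_eq_add]

/-- Translation of configurations. -/
def shift (x : ℤ × ℤ) (ω : Config) : Config :=
  (fun v => ω.1 (v + x), fun e => ω.2 (shiftEdge x e))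

theorem measurePreserving_shift (ρ : PMF (Fin 4)) (x : ℤ × ℤ) :
    MeasurePreserving (shift x) (law ρ) (law ρ) := by
  refine MeasurePreserving.prod (f := fun (κ : ℤ × ℤ → Fin 4) v => κ (v + x))
    (g := fun (U : Edge → ℝ) e => U (shiftEdge x e))
    ⟨by fun_prop, ?_⟩ ⟨by fun_prop, ?_⟩
  · exact Measure.map_infinitePi_infinitePi_of_inj (P := fun _ : ℤ × ℤ => ρ.toMeasure)
      (add_left_injective x)
  · exact Measure.map_infinitePi_infinitePi_of_inj (P := fun _ : Edge => uniformLaw)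
      (shiftEdge x).injective

theorem precedes_shift {x : ℤ × ℤ} {ω : Config} {e f : Edge} :
    Precedes (shift x ω).2 f e ↔ Precedes ω.2 (shiftEdge x f) (shiftEdge x e) := by
  refine and_congr_left fun _ => ?_
  simp only [mem_shiftEdge]
  exact ⟨fun ⟨v, h⟩ => ⟨v + x, by simpa using h⟩, fun ⟨v, h⟩ => ⟨v - x, h⟩⟩

theorem wellFounded_shift {x : ℤ × ℤ} {ω : Config} (h : WellFounded (Precedes ω.2)) :
    WellFounded (Precedes (shift x ω).2) :=
  Subrelation.wf (r := InvImage (Precedes ω.2) (shiftEdge x)) (fun h => precedes_shift.1 h)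
    (InvImage.wf _ h)

theorem succeeds_shift {x : ℤ × ℤ} {ω : Config} (h : WellFounded (Precedes ω.2)) (e : Edge) :
    Succeeds (shift x ω).1 (shift x ω).2 e ↔ Succeeds ω.1 ω.2 (shiftEdge x e) := by
  have h' := wellFounded_shift (x := x) h
  induction e using h'.induction with
  | _ e ih =>
    rw [succeeds_iff h, succeeds_iff h']
    have key : ∀ v, {f : Edge | v + x ∈ f.1 ∧ Precedes ω.2 f (shiftEdge x e) ∧
        Succeeds ω.1 ω.2 f}.ncard = {f : Edge | v ∈ f.1 ∧ Precedes (shift x ω).2 f e ∧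
        Succeeds (shift x ω).1 (shift x ω).2 f}.ncard := by
      intro v
      refine Eq.trans ?_ (Set.ncard_image_of_injective _ (shiftEdge x).injective)
      congr 1
      ext f
      obtain ⟨f, rfl⟩ := (shiftEdge x).surjective f
      rw [(shiftEdge x).injective.mem_set_image]
      simp only [Set.mem_ofPred_eq, mem_shiftEdge, add_sub_cancel_right, ← precedes_shift]
      exact and_congr_right fun _ => and_congr_right fun hf => (ih f hf).symm
    constructor
    · intro hs w hw
      have := hs (w - x) (mem_shiftEdge.1 hw)
      rw [← key, sub_add_cancel] at this
      simpa [shift] using this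
    · intro hs v hv
      rw [← key]
      exact hs (v + x) (mem_shiftEdge.2 (by simpa using hv))

theorem openGraph_shift_adj {x : ℤ × ℤ} {ω : Config} (h : WellFounded (Precedes ω.2)) {t : ℝ}
    {u v : ℤ × ℤ} (hadj : (openGraph ω.1 ω.2 t).Adj u v) :
    (openGraph (shift x ω).1 (shift x ω).2 t).Adj (u - x) (v - x) := by
  obtain ⟨hs, h1, h2⟩ := hadj
  have hs' : s(u - x, v - x) ∈ squareLattice.edgeSet :=
    (shiftIso x).map_adj_iff.1 (by simpa [shiftIso] using hs)
  have he : shiftEdge x ⟨s(u - x, v - x), hs'⟩ = ⟨s(u, v), hs⟩ := by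
    rw [shiftEdge_mk x _ _ hs' (by simpa using hs)]
    simp
  refine ⟨hs', ?_, ?_⟩
  · change ω.2 (shiftEdge x _) ≤ t
    rwa [he]
  · rwa [succeeds_shift h, he]

theorem openGraph_shift_reachable {x : ℤ × ℤ} {ω : Config} (h : WellFounded (Precedes ω.2))
    {t : ℝ} {u v : ℤ × ℤ} (hr : (openGraph ω.1 ω.2 t).Reachable u v) :
    (openGraph (shift x ω).1 (shift x ω).2 t).Reachable (u - x) (v - x) :=
  hr.map (⟨fun w => w - x, fun hadj => openGraph_shift_adj h hadj⟩ :
    openGraph ω.1 ω.2 t →g openGraph (shift x ω).1 (shift x ω).2 t)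

/-- The sites of the box of radius `N` around `x`. -/
def boxSitesAt (N : ℕ) (x : ℤ × ℤ) : Set ((ℤ × ℤ) ⊕ Edge) :=
  {i | Sum.elim (fun v => nm (v - x) ≤ N) (fun e => ∀ v ∈ e.1, nm (v - x) ≤ N) i}

theorem measurable_shift (N : ℕ) (x : ℤ × ℤ) :
    Measurable[localSigma (boxSitesAt N x), localSigma (boxSites N)] (shift x) := by
  rw [measurable_iff_comap_le]
  simp only [localSigma, MeasurableSpace.comap_iSup]
  refine iSup₂_le fun i hi => ?_
  cases i with
  | inl v =>
    rw [coordSigma, MeasurableSpace.comap_comp]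
    refine le_iSup₂_of_le (f := fun i _ => coordSigma i) (Sum.inl (v + x)) ?_ le_rfl
    simpa [boxSitesAt, boxSites] using hi
  | inr e =>
    rw [coordSigma, MeasurableSpace.comap_comp]
    refine le_iSup₂_of_le (f := fun i _ => coordSigma i) (Sum.inr (shiftEdge x e)) ?_ le_rfl
    exact fun w hw => hi (w - x) (mem_shiftEdge.1 hw)

theorem disjoint_boxSitesAt {N : ℕ} {x y : ℤ × ℤ} (h : 2 * N < nm (y - x)) :
    Disjoint (boxSitesAt N x) (boxSitesAt N y) := by
  have key : ∀ v : ℤ × ℤ, nm (v - x) ≤ N → nm (v - y) ≤ N → False := by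
    intro v h1 h2
    simp only [nm, Prod.fst_sub, Prod.snd_sub] at h h1 h2
    omega
  refine Set.disjoint_left.2 ?_
  rintro (v | e) h1 h2
  · exact key v h1 h2
  · exact key _ (h1 _ (Sym2.out_fst_mem e.1)) (h2 _ (Sym2.out_fst_mem e.1))

end shift

/-- The local event, around `x`, that contains an open arm from `x` to distance `L`. -/
def armEvent (L : ℕ) (t : ℝ) (x : ℤ × ℤ) : Set Config :=
  shift x ⁻¹' ({ω | TruncArm L t ω} ∪ {ω | Bad L ω})

theorem measurableSet_armEvent (L : ℕ) (t : ℝ) (x : ℤ × ℤ) :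
    MeasurableSet[localSigma (boxSitesAt (2 * L) x)] (armEvent L t x) :=
  measurable_shift (2 * L) x ((measurableSet_truncArm L t).union (measurableSet_bad L))

theorem measure_armEvent (ρ : PMF (Fin 4)) (L : ℕ) (t : ℝ) (x : ℤ × ℤ) :
    law ρ (armEvent L t x) = law ρ ({ω | TruncArm L t ω} ∪ {ω | Bad L ω}) :=
  (measurePreserving_shift ρ x).measure_preimage
    (localSigma_le _ _ ((measurableSet_truncArm L t).union
      (measurableSet_bad L))).nullMeasurableSet

theorem mem_armEvent {L : ℕ} {t : ℝ} (ht : t < 1) {ω : Config}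
    (hω : WellFounded (Precedes ω.2)) {x v : ℤ × ℤ} (hv : L ≤ nm (v - x))
    (h : (openGraph ω.1 ω.2 t).Reachable x v) : ω ∈ armEvent L t x := by
  by_cases hb : Bad L (shift x ω)
  · exact .inr hb
  · refine .inl (truncArm_of_reachable (wellFounded_shift hω) ht hb hv ?_)
    simpa using openGraph_shift_reachable (x := x) hω h

section lastExit

variable {G : SimpleGraph (ℤ × ℤ)}

/-- Either a walk avoids the ball of radius `R` around `x`, or its part after the last visit to the
ball starts at distance `R + 1` from `x`. -/
theorem exists_walk_after_last_exit (hG : G ≤ squareLattice) {R : ℕ} {x u v : ℤ × ℤ}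
    (hv : R < nm (v - x)) (p : G.Walk u v) :
    (∀ w ∈ p.support, R < nm (w - x)) ∨ ∃ (u' : ℤ × ℤ) (q : G.Walk u' v),
      nm (u' - x) = R + 1 ∧ (∀ w ∈ q.support, R < nm (w - x)) ∧ q.support ⊆ p.support := by
  induction p with
  | nil => exact .inl (by simpa using hv)
  | @cons a b c hab p ih =>
    rcases ih hv with h | ⟨u', q, h1, h2, h3⟩
    · by_cases ha : R < nm (a - x)
      · refine .inl fun w hw => ?_
        rw [SimpleGraph.Walk.support_cons, List.mem_cons] at hw
        rcases hw with rfl | hw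
        · exact ha
        · exact h w hw
      · refine .inr ⟨b, p, ?_, h, by simp⟩
        have := nm_sub_le_of_adj (x := x) (hG hab)
        have := h b p.start_mem_support
        omega
    · exact .inr ⟨u', q, h1, h2, fun w hw => by simp [h3 hw]⟩

/-- A long walk visits a chain of well separated vertices with bounded steps. -/
theorem exists_separated_list (hG : G ≤ squareLattice) {R : ℕ} (k : ℕ) {x v : ℤ × ℤ}
    (p : G.Walk x v) (h : (k + 1) * (R + 1) ≤ nm (v - x)) :
    ∃ l ∈ walks (ring (R + 1)) k x, l.Pairwise (fun a b => R < nm (b - a)) ∧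
      ∀ y ∈ l, y ∈ p.support ∧ R < nm (v - y) := by
  induction k generalizing x with
  | zero =>
    refine ⟨[x], by simp [walks], by simp, fun y hy => ?_⟩
    rw [List.mem_singleton] at hy
    subst hy
    exact ⟨p.start_mem_support, by omega⟩
  | succ k ih =>
    have hv : R < nm (v - x) := by nlinarith
    rcases exists_walk_after_last_exit hG hv p with h0 | ⟨u, q, h1, h2, h3⟩
    · have := h0 x p.start_mem_support
      simp [nm] at this
    · obtain ⟨l, hl, hp, hmem⟩ := ih q (by
        have : nm (v - x) ≤ nm (v - u) + nm (u - x) := by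
          simp only [nm, Prod.fst_sub, Prod.snd_sub]
          omega
        rw [h1] at this
        nlinarith)
      refine ⟨x :: l, ?_, ?_, ?_⟩
      · simp only [walks, Finset.mem_biUnion, Finset.mem_image]
        exact ⟨u, mem_ring h1, l, hl, rfl⟩
      · exact List.pairwise_cons.2 ⟨fun y hy => h2 y (hmem y hy).1, hp⟩
      · intro y hy
        rcases List.mem_cons.1 hy with rfl | hy
        · exact ⟨p.start_mem_support, hv⟩
        · exact ⟨h3 (hmem y hy).1, (hmem y hy).2⟩

end lastExit

theorem nm_of_mem_vertexBoundary_box {n : ℕ} {v : ℤ × ℤ} (hv : v ∈ vertexBoundary (box n)) :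
    nm v = n := by
  obtain ⟨⟨h1, h2⟩, w, hw, hadj⟩ := hv
  have h3 : ¬ nm w ≤ n := by
    intro h
    refine hw ⟨?_, ?_⟩ <;> rw [Int.abs_eq_natAbs] <;> simp only [nm] at h <;> omega
  have h4 := nm_le_of_adj hadj
  rw [Int.abs_eq_natAbs] at h1 h2
  have : nm v ≤ n := by simp only [nm]; omega
  omega

theorem theta_le_pow (ρ : PMF (Fin 4)) {L : ℕ} {t : ℝ} (ht : t < 1) {p : ℝ≥0∞}
    (hp : law ρ ({ω | TruncArm L t ω} ∪ {ω | Bad L ω}) ≤ p) {k n : ℕ}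
    (hn : (k + 1) * (4 * L + 1) ≤ n) :
    law ρ {x | ∃ v ∈ vertexBoundary (box n), (openGraph x.1 x.2 t).Reachable 0 v} ≤
      ((4 * (2 * (4 * L + 1) + 1) : ℕ) : ℝ≥0∞) ^ k * p ^ (k + 1) := by
  classical
  set W := (walks (ring (4 * L + 1)) k 0).filter
    fun l => l.Pairwise fun a b : ℤ × ℤ => 4 * L < nm (b - a)
  have hsub : {x : Config | ∃ v ∈ vertexBoundary (box n), (openGraph x.1 x.2 t).Reachable 0 v}
      ≤ᵐ[law ρ] (⋃ l ∈ W, {x | ∀ y ∈ l, x ∈ armEvent L t y} : Set Config) := by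
    filter_upwards [ae_wellFounded ρ] with x hx
    rintro ⟨v, hv, ⟨q⟩⟩
    have hvn := nm_of_mem_vertexBoundary_box hv
    obtain ⟨l, hl, hsep, hmem⟩ := exists_separated_list (openGraph_le _ _ _) k q
      (by simpa [hvn] using hn)
    refine Set.mem_biUnion (x := l) (Finset.mem_coe.2 (Finset.mem_filter.2 ⟨hl, hsep⟩))
      fun y hy => ?_
    obtain ⟨hy1, hy2⟩ := hmem y hy
    exact mem_armEvent ht hx (by omega) (q.dropUntil y hy1).reachable
  refine (measure_mono_ae hsub).trans ((measure_biUnion_finset_le _ _).trans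
    ((Finset.sum_le_card_nsmul _ _ (p ^ (k + 1)) fun l hl => ?_).trans ?_))
  · obtain ⟨hl, hsep⟩ := Finset.mem_filter.1 hl
    rw [← length_of_mem_walks hl]
    exact (measure_biInter_list_le ρ (boxSitesAt (2 * L)) (armEvent L t)
      (measurableSet_armEvent L t) p (fun y => (measure_armEvent ρ L t y).trans_le hp) l
      (hsep.imp fun h => disjoint_boxSitesAt (by omega))).2
  · rw [nsmul_eq_mul]
    gcongr
    exact_mod_cast (Finset.card_filter_le _ _).trans (card_walks_le (card_ring_le _) k 0)

theorem measure_bad_le (ρ : PMF (Fin 4)) (L : ℕ) :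
    (law ρ).real {ω | Bad L ω} ≤ 4 * (2 * L + 1) ^ 2 * (8 ^ L / ((L + 1).factorial : ℝ)) := by
  have hsub : {ω : Config | Bad L ω} ⊆ ⋃ e ∈ boxEdges L, {ω | HasDescent ω.2 L e} :=
    fun ω ⟨e, he, hd⟩ => Set.mem_biUnion (mem_boxEdges.2 he) hd
  have h1 : law ρ {ω | Bad L ω} ≤
      ENNReal.ofReal (4 * (2 * L + 1) ^ 2 * (8 ^ L / ((L + 1).factorial : ℝ))) := by
    refine (measure_mono hsub).trans ((measure_biUnion_finset_le _ _).trans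
      ((Finset.sum_le_card_nsmul _ _ _ fun e _ => measure_hasDescent_le ρ L e).trans ?_))
    rw [nsmul_eq_mul, ENNReal.ofReal_mul (by positivity),
      ENNReal.ofReal_div_of_pos (by positivity), ENNReal.ofReal_pow (by norm_num),
      ENNReal.ofReal_natCast, div_eq_mul_inv]
    have h2 : (4 * (2 * L + 1) ^ 2 : ℝ) = ((4 * (2 * L + 1) ^ 2 : ℕ) : ℝ) := by push_cast; ring
    have h3 : ENNReal.ofReal 8 = 8 := by norm_num
    rw [h2, ENNReal.ofReal_natCast, h3]
    gcongr
    exact card_boxEdges_le L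
  exact ENNReal.toReal_le_of_le_ofReal (by positivity) h1

/-- The local arm events are summable when the expected cluster size is finite. -/
theorem summable_truncArm (ρ : PMF (Fin 4)) {t : ℝ} (ht : t < 1)
    (h : expectedClusterSize ρ t < ⊤) :
    Summable fun L : ℕ => (law ρ).real ({ω | TruncArm L t ω} \ {ω | Bad L ω}) := by
  set A : ℕ → Set Config := fun L => {ω | TruncArm L t ω} \ {ω | Bad L ω}
  have hA : ∀ L, MeasurableSet (A L) := fun L =>
    localSigma_le _ _ ((measurableSet_truncArm L t).diff (measurableSet_bad L))
  refine ENNReal.summable_toReal (f := fun L => law ρ (A L)) ?_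
  refine ne_of_lt (lt_of_le_of_lt ?_ h)
  calc ∑' L, law ρ (A L) = ∑' L, ∫⁻ ω, (A L).indicator 1 ω ∂(law ρ) := by
        simp_rw [lintegral_indicator_one (hA _)]
    _ = ∫⁻ ω, ∑' L, (A L).indicator 1 ω ∂(law ρ) :=
        (lintegral_tsum fun L => (measurable_one.indicator (hA L)).aemeasurable).symm
    _ ≤ expectedClusterSize ρ t := by
        refine lintegral_mono_ae ?_
        filter_upwards [ae_wellFounded ρ] with ω hω
        have h1 : ∑' L, (A L).indicator (1 : Config → ℝ≥0∞) ω = (({L | ω ∈ A L}.encard : ℕ∞) : ℝ≥0∞) := by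
          have : ∀ L, (A L).indicator (1 : Config → ℝ≥0∞) ω =
              {L | ω ∈ A L}.indicator (1 : ℕ → ℝ≥0∞) L := fun L => rfl
          simp_rw [this]
          rw [← Measure.count_apply .of_discrete, ← lintegral_indicator_one .of_discrete,
            lintegral_count]
        rw [h1]
        refine ENat.toENNReal_mono ?_
        have h2 : ∀ L : {L | ω ∈ A L}, ∃ w ∈ cluster ω.1 ω.2 t, nm w = L := fun L =>
          exists_mem_cluster_of_truncArm hω ht L.2.2 L.2.1
        choose w hw hL using h2
        have hinj : Injective fun L => (⟨w L, hw L⟩ : cluster ω.1 ω.2 t) := by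
          intro L M hLM
          have : w L = w M := congrArg Subtype.val hLM
          exact Subtype.ext (by rw [← hL L, ← hL M, this])
        exact ENat.card_le_card_of_injective hinj

/-- At some scale the local arm event is rarer than the inverse of the number of sites of a ring
at that scale. -/
theorem exists_good_scale (ρ : PMF (Fin 4)) {t : ℝ} (ht : t < 1)
    (h : expectedClusterSize ρ t < ⊤) :
    ∃ L : ℕ, ((4 * (2 * (4 * L + 1) + 1) : ℕ) : ℝ) *
      (law ρ).real ({ω | TruncArm L t ω} ∪ {ω | Bad L ω}) ≤ 1 / 2 := by
  by_contra! hcon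
  have hbad : Filter.Tendsto (fun L : ℕ => 44 * 36 * ((L : ℝ) ^ 3 *
      (8 ^ L / ((L + 1).factorial : ℝ)))) Filter.atTop (nhds 0) := by
    simpa using (tendsto_pow_mul_descent 3).const_mul (44 * 36)
  obtain ⟨N, hN⟩ := Filter.eventually_atTop.1
    (hbad.eventually (gt_mem_nhds (show (0 : ℝ) < 1 / 4 by norm_num)))
  have hle : ∀ L : ℕ, N + 1 ≤ L → (1 / 176) * (1 / (L : ℝ)) ≤
      (law ρ).real ({ω | TruncArm L t ω} \ {ω | Bad L ω}) := by
    intro L hL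
    have hL1 : (1 : ℝ) ≤ L := by exact_mod_cast (by omega : 1 ≤ L)
    set a := (law ρ).real ({ω | TruncArm L t ω} \ {ω | Bad L ω})
    set b := (law ρ).real {ω | Bad L ω}
    have h1 : (law ρ).real ({ω | TruncArm L t ω} ∪ {ω | Bad L ω}) ≤ a + b := by
      rw [← Set.sdiff_union_self]
      exact measureReal_union_le _ _
    have h2 := hcon L
    have h3 := hN L (by omega)
    have h4 := measure_bad_le ρ L
    set c := (8 : ℝ) ^ L / ((L + 1).factorial : ℝ)
    have hc : 0 ≤ c := by positivity
    have ha : 0 ≤ a := measureReal_nonneg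
    have hb : 0 ≤ b := measureReal_nonneg
    have h5 : ((4 * (2 * (4 * L + 1) + 1) : ℕ) : ℝ) ≤ 44 * L := by
      push_cast
      linarith
    have h6 : b ≤ 36 * L ^ 2 * c := by
      refine h4.trans (mul_le_mul_of_nonneg_right ?_ hc)
      nlinarith
    have h7 : (1 : ℝ) / 2 < 44 * L * (a + b) :=
      h2.trans_le (mul_le_mul h5 h1 measureReal_nonneg (by positivity))
    have h8 : 44 * L * b ≤ 44 * 36 * ((L : ℝ) ^ 3 * c) := by
      calc 44 * L * b ≤ 44 * L * (36 * L ^ 2 * c) := by gcongr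
        _ = _ := by ring
    have h9 : (1 : ℝ) / 4 ≤ 44 * L * a := by linarith
    rw [one_div_mul_one_div, div_le_iff₀ (by positivity)]
    linarith
  have hs := (summable_nat_add_iff (N + 1)).2 (summable_truncArm ρ ht h)
  have hs2 : Summable fun L : ℕ => (1 / 176) * (1 / ((L + (N + 1) : ℕ) : ℝ)) :=
    hs.of_nonneg_of_le (fun L => by positivity) fun L => hle _ (by omega)
  have hs3 := (summable_nat_add_iff (f := fun L : ℕ => (1 / 176) * (1 / (L : ℝ))) (N + 1)).1 hs2
  exact Real.not_summable_one_div_natCast ((summable_mul_left_iff (by norm_num)).1 hs3)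

theorem theta_le_half_pow (ρ : PMF (Fin 4)) {t : ℝ} (ht : t < 1)
    (h : expectedClusterSize ρ t < ⊤) :
    ∃ M : ℕ, 1 ≤ M ∧ ∀ k n : ℕ, (k + 1) * M ≤ n → theta ρ n t ≤ (1 / 2) ^ k := by
  obtain ⟨L, hL⟩ := exists_good_scale ρ ht h
  refine ⟨4 * L + 1, by omega, fun k n hn => ?_⟩
  set C := 4 * (2 * (4 * L + 1) + 1)
  set B := {ω : Config | TruncArm L t ω} ∪ {ω | Bad L ω}
  have h1 := ENNReal.toReal_mono (ENNReal.mul_ne_top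
    (ENNReal.pow_ne_top (ENNReal.natCast_ne_top _)) (ENNReal.pow_ne_top (measure_ne_top _ _)))
    (theta_le_pow ρ ht (le_refl (law ρ B)) hn)
  rw [ENNReal.toReal_mul, ENNReal.toReal_pow, ENNReal.toReal_pow, ENNReal.toReal_natCast] at h1
  change theta ρ n t ≤ (C : ℝ) ^ k * (law ρ).real B ^ (k + 1) at h1
  calc theta ρ n t ≤ (C : ℝ) ^ k * (law ρ).real B ^ (k + 1) := h1
    _ = ((C : ℝ) * (law ρ).real B) ^ k * (law ρ).real B := by rw [mul_pow, pow_succ]; ring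
    _ ≤ (1 / 2) ^ k * 1 := by
        gcongr
        exact measureReal_le_one
    _ = (1 / 2) ^ k := mul_one _

/-- Before time `1` the origin is isolated with positive probability. -/
theorem exists_theta_le_lt_one (ρ : PMF (Fin 4)) {t : ℝ} (h0 : 0 ≤ t) (ht : t < 1) :
    ∃ q < 1, 0 < q ∧ ∀ n : ℕ, 1 ≤ n → theta ρ n t ≤ q := by
  set I : Set Config := Set.univ ×ˢ Set.pi (incident 0 : Set Edge) fun _ => Set.Ioi t
  have hI : MeasurableSet I :=
    MeasurableSet.univ.prod (.pi (incident 0).countable_toSet fun _ _ => measurableSet_Ioi)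
  have hmeas : law ρ I = ENNReal.ofReal (1 - t) ^ (incident 0).card := by
    have : uniformLaw (Set.Ioi t) = ENNReal.ofReal (1 - t) := by
      have hset : Set.Ioi t ∩ Set.Ioc 0 1 = Set.Ioc t 1 := by
        ext u
        exact ⟨fun h => ⟨h.1, h.2.2⟩, fun h => ⟨h.1, h0.trans_lt h.1, h.2⟩⟩
      rw [uniformLaw, Measure.restrict_apply measurableSet_Ioi, hset, Real.volume_Ioc]
    rw [law, Measure.prod_prod, measure_univ, one_mul,
      Measure.infinitePi_pi _ fun _ _ => measurableSet_Ioi]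
    simp [this]
  have hpos : 0 < (law ρ).real I := by
    rw [measureReal_def, hmeas, ENNReal.toReal_pow, ENNReal.toReal_ofReal (by linarith)]
    exact pow_pos (by linarith) _
  refine ⟨max (1 - (law ρ).real I) (1 / 2), max_lt (by linarith) (by norm_num),
    lt_max_of_lt_right (by norm_num), fun n hn => le_max_of_le_left ?_⟩
  rw [← probReal_compl_eq_one_sub hI]
  refine measureReal_mono ?_
  rintro x ⟨v, hv, ⟨q⟩⟩ hx
  have hvn := nm_of_mem_vertexBoundary_box hv
  cases q with
  | nil => simp [nm] at hvn; omega
  | cons hadj _ =>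
    obtain ⟨hs, ho, -⟩ := hadj
    exact absurd ho (not_le.2 (hx.2 _ (Finset.mem_coe.2 (mem_incident.2 (Sym2.mem_mk_left _ _)))))

end CDPRE

open CDPRE in
theorem theorem2 (ρ : PMF (Fin 4)) (t : ℝ) (ht : t ∈ Set.Icc (0 : ℝ) 1) (htc : t < CDPRE.tBar ρ)
    (ε : ℝ) (hε : 0 < ε) :
    ∃ α : ℝ, 0 < α ∧ ∀ n : ℕ, 1 ≤ n →
      CDPRE.theta ρ n t ≤ Real.exp (-α * (n : ℝ) ^ (1 - ε)) := by
  have hne : {t : ℝ | t ∈ Set.Icc (0 : ℝ) 1 ∧ expectedClusterSize ρ t < ⊤}.Nonempty := by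
    by_contra hempty
    rw [Set.not_nonempty_iff_eq_empty] at hempty
    rw [tBar, hempty, Real.sSup_empty] at htc
    exact absurd ht.1 (not_le.2 htc)
  obtain ⟨s, ⟨hs1, hs2⟩, hts⟩ := exists_lt_of_lt_csSup hne htc
  have ht1 : t < 1 := hts.trans_le hs1.2
  obtain ⟨M, hM, hdecay⟩ := theta_le_half_pow ρ ht1
    ((expectedClusterSize_mono ρ hts.le).trans_lt hs2)
  obtain ⟨q, hq1, hq0, hq⟩ := exists_theta_le_lt_one ρ ht.1 ht1
  have hM0 : (0 : ℝ) < M := by exact_mod_cast hM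
  have hlog2 : 0 < Real.log 2 := Real.log_pos (by norm_num)
  have hlogq : Real.log q < 0 := Real.log_neg hq0 hq1
  set α := min (Real.log 2 / (2 * M)) (-Real.log q / (4 * M))
  have hα : 0 < α := lt_min (by positivity) (div_pos (by linarith) (by positivity))
  refine ⟨α, hα, fun n hn => ?_⟩
  have hn1 : (1 : ℝ) ≤ n := by exact_mod_cast hn
  have hpow : (n : ℝ) ^ (1 - ε) ≤ n :=
    (Real.rpow_le_rpow_of_exponent_le hn1 (by linarith)).trans_eq (Real.rpow_one _)
  suffices h : theta ρ n t ≤ Real.exp (-α * n) by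
    refine h.trans (Real.exp_le_exp.2 ?_)
    nlinarith
  rcases lt_or_ge n (4 * M) with hlt | hge
  · refine (hq n hn).trans ?_
    rw [← Real.exp_log hq0]
    refine Real.exp_le_exp.2 ?_
    have h1 : α ≤ -Real.log q / (4 * M) := min_le_right _ _
    rw [le_div_iff₀ (by positivity)] at h1
    have h2 : (n : ℝ) ≤ 4 * M := by exact_mod_cast hlt.le
    nlinarith
  · obtain ⟨k, hk⟩ : ∃ k, n / M = k + 1 := Nat.exists_eq_succ_of_ne_zero
      (Nat.div_pos (by omega) hM).ne'
    have h1 : (k + 1) * M ≤ n := hk ▸ Nat.div_mul_le_self n M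
    have h2 : n < (k + 2) * M := by
      have := Nat.lt_div_mul_add (a := n) hM
      rw [hk] at this
      linarith
    refine (hdecay k n h1).trans ?_
    have h3 : ((1 : ℝ) / 2) ^ k = Real.exp (-(k * Real.log 2)) := by
      rw [one_div, inv_pow, Real.exp_neg, mul_comm, Real.exp_mul, Real.exp_log (by norm_num),
        Real.rpow_natCast]
    rw [h3]
    refine Real.exp_le_exp.2 ?_
    have h4 : α ≤ Real.log 2 / (2 * M) := min_le_left _ _
    rw [le_div_iff₀ (by positivity)] at h4
    have h5 : (n : ℝ) < (k + 2) * M := by exact_mod_cast h2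
    have h6 : (4 : ℝ) * M ≤ n := by exact_mod_cast hge
    have h7 : (n : ℝ) ≤ 2 * M * k := by linarith
    have h8 : α * n ≤ k * Real.log 2 :=
      calc α * n ≤ α * (2 * M * k) := by gcongr
        _ = α * (2 * M) * k := by ring
        _ ≤ Real.log 2 * k := by gcongr
        _ = _ := mul_comm _ _
    linarith

end
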